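/- Let $S=\mathbb C[x,y,z]$, let $C:f=0$ be a reduced curve of degree $d\ge 3$ in $\mathbb P^2$ over $\mathbb C$ (so $f\in S$ is homogeneous of degree $d$ and square-free), let $J_f=(f_x,f_y,f_z)$ be the Jacobian ideal, $M(f)=S/J_f$ the Milnor algebra and $$D_0(f)=\{(a,b,c)\in S^3 : af_x+bf_y+cf_z=0\}$$ the graded module of Jacobian syzygies. Let $\tau(C)$ be the total Tjurina number of $C$, that is, the degree of $J_f$ (the constant value of the Hilbert polynomial of $M(f)$). The curve $C$ is said to be of type $(d,r,m)$ if $D_0(f)$ is minimally generated by $m$ homogeneous syzygies, all of the same degree $r$. Put $\Delta m=(2r-d+3)-m$. Assume that $C$ is of type $(d,r,m)$ with $m>3$ and $\Delta m=3$. Then $M(f)$ has a minimal graded free resolution of the form $$0\to \bigoplus_{j=1}^{m-2}S(-e_j)\to S(1-d-r)^m\to S^3(1-d)\to S,\qquad e_1\le\dots\le e_{m-2},$$ and if the integers $\epsilon_j$ are defined by $e_j=d+r-1+\epsilon_j$ for $1\le j\le m-2$, then one of the following three cases holds: 1. $\epsilon_{m-2}=4$, $\epsilon_j=1$ for $1\le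 j\le m-3$, and $\tau(C)=\frac{d(d-1)}2-6+r(d-r-2)$; 2. $\epsilon_{m-2}=3$, $\epsilon_{m-3}=2$, $\epsilon_j=1$ for $1\le j\le m-4$, and $\tau(C)=\frac{d(d-1)}2-4+r(d-r-2)$; 3. $m\ge 5$, $\epsilon_{m-2}=\epsilon_{m-3}=\epsilon_{m-4}=2$, $\epsilon_j=1$ for $1\le j\le m-5$, and $\tau(C)=\frac{d(d-1)}2-3+r(d-r-2)$. -/

import Mathlib

open Filter

namespace JacobianSyzygies

/-- The polynomial ring `S = ℂ[x, y, z]`. -/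
abbrev S : Type := MvPolynomial (Fin 3) ℂ

/-- The Jacobian ideal `J_f`, generated by the three partial derivatives of `f`. -/
noncomputable def jacobianIdeal (f : S) : Ideal S :=
  Ideal.span (Set.range fun i : Fin 3 => MvPolynomial.pderiv i f)

/-- The map `S³ → S`, `(a, b, c) ↦ a f_x + b f_y + c f_z`. -/
noncomputable def gradientMap (f : S) : (Fin 3 → S) →ₗ[S] S :=
  Fintype.linearCombination S fun i : Fin 3 => MvPolynomial.pderiv i f

/-- The module `D₀(f)` of Jacobian syzygies: all `(a, b, c)` with `a f_x + b f_y + c f_z = 0`. -/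
noncomputable def D0 (f : S) : Submodule S (Fin 3 → S) :=
  LinearMap.ker (gradientMap f)

/-- `ρ₁, …, ρ_m` is a minimal set of homogeneous generators of `D₀(f)`, with
`deg ρ_j = δ_j` and `δ₁ ≤ ⋯ ≤ δ_m`. -/
structure IsMinimalGenerators (f : S) {m : ℕ} (δ : Fin m → ℕ) (ρ : Fin m → Fin 3 → S) :
    Prop where
  monotone : Monotone δ
  homogeneous : ∀ j i, (ρ j i).IsHomogeneous (δ j)
  span_eq : Submodule.span S (Set.range ρ) = D0 f
  irredundant : ∀ j, ρ j ∉ Submodule.span S (ρ '' {j}ᶜ)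

/-- `C : f = 0` is a reduced plane curve of degree `d ≥ 3` which is of type `(d, r, m)`:
the module `D₀(f)` is minimally generated by `m` homogeneous syzygies, all of degree `r`. -/
def IsCurveOfType (f : S) (d r m : ℕ) : Prop :=
  3 ≤ d ∧ f.IsHomogeneous d ∧ Squarefree f ∧
    ∃ ρ : Fin m → Fin 3 → S, IsMinimalGenerators f (fun _ => r) ρ

/-- `Δm = m(d, r)_max - m`, where `m(d, r)_max = 2 r - d + 3`. -/
def deltaM (d r m : ℕ) : ℤ :=
  (2 * (r : ℤ) - d + 3) - m

/-- The dimension of the degree `k` component `M(f)_k` of the Milnor algebra `M(f) = S / J_f`,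
that is, of the image of `S_k` in `S / J_f`. -/
noncomputable def milnorDim (f : S) (k : ℕ) : ℕ :=
  Module.finrank ℂ ((MvPolynomial.homogeneousSubmodule (Fin 3) ℂ k).map
    (Ideal.Quotient.mkₐ ℂ (jacobianIdeal f)).toLinearMap)

/-- `τ` is the total Tjurina number of the reduced curve `C : f = 0`, that is, the degree of
the Jacobian ideal `J_f`: the Hilbert polynomial of `S / J_f` is the constant `τ`. -/
def IsTotalTjurina (f : S) (τ : ℕ) : Prop :=
  ∀ᶠ k in atTop, milnorDim f k = τ

/-- `p` is homogeneous of degree `k ∈ ℤ` (so `p = 0` if `k < 0`). -/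
def IsHomogeneousInt (p : S) (k : ℤ) : Prop :=
  ∀ u : Fin 3 →₀ ℕ, p.coeff u ≠ 0 → (u.degree : ℤ) = k

/-- The matrix `A` defines a morphism of graded modules `⨁ᵢ S(-aᵢ) → ⨁ⱼ S(-bⱼ)`. -/
def IsGradedMatrix {ι κ : Type} (a : ι → ℤ) (b : κ → ℤ) (A : Matrix κ ι S) : Prop :=
  ∀ j i, IsHomogeneousInt (A j i) (a i - b j)

/-- The matrices `A`, `B` and the gradient of `f` form a minimal graded free resolution
`0 → ⨁ᵢ S(-eᵢ) → ⨁ⱼ S(1 - d - δⱼ) → S³(1 - d) → S` of the Milnor algebra `M(f) = S / J_f`,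
with `e₁ ≤ ⋯ ≤ eₙ` and `δ₁ ≤ ⋯ ≤ δ_m`.  Minimality means that no entry of
`A` and `B` has a constant term (the same is automatic for the partial derivatives of `f`
when `f` is homogeneous of degree `d ≥ 3`). -/
structure IsMinimalResolution (f : S) (d : ℕ) {m n : ℕ} (δ : Fin m → ℕ) (e : Fin n → ℤ)
    (A : Matrix (Fin 3) (Fin m) S) (B : Matrix (Fin m) (Fin n) S) : Prop where
  monotone_δ : Monotone δ
  monotone_e : Monotone e
  graded_A : IsGradedMatrix (fun j => (d : ℤ) - 1 + δ j) (fun _ => (d : ℤ) - 1) A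
  graded_B : IsGradedMatrix e (fun j => (d : ℤ) - 1 + δ j) B
  exact_gradient : Function.Exact A.mulVecLin (gradientMap f)
  exact_A : Function.Exact B.mulVecLin A.mulVecLin
  injective_B : Function.Injective B.mulVecLin
  minimal_A : ∀ i j, MvPolynomial.constantCoeff (A i j) = 0
  minimal_B : ∀ i j, MvPolynomial.constantCoeff (B i j) = 0

/-- The integers `ε_j` defined by `e_j = d + d_{j+2} - 1 + ε_j` for `j = 1, …, m - 2`
(in the code `j` runs from `0` to `m - 3`, so `ε_j` is the value at `j - 1`). -/
def epsilon (d : ℕ) {m : ℕ} (δ : Fin m → ℕ) (e : Fin (m - 2) → ℤ) (j : Fin (m - 2)) : ℤ :=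
  e j - ((d : ℤ) + δ ⟨j.val + 2, by omega⟩ - 1)

end JacobianSyzygies

/-!
Write `S = ℂ[x, y, z]`. The second syzygy module of `M(f)` is the kernel of a map of free modules
whose image lies in a free module with torsion-free quotient, so `x, y, z` is a regular sequence on
it. Tensoring with `S / (x, y, z)` and applying Nakayama's lemma, its minimal homogeneous generators
are free, which gives the resolution.

For a suitable `t`, one partial derivative of `f` is coprime to a combination `a + t b` of the other
two, because `f` is square-free. By Bézout the Hilbert function of `M(f)` is then at most
`(d - 1) ^ 2` in large degrees, so the Hilbert polynomial computed from the resolution is constant.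
Its three coefficients say that the last free module has rank `m - 2`, that `∑ (ε_j - 1) = Δm`, and
that `2 τ = d (d - 1) + 2 r (d - r - 2) - ∑ ε_j (ε_j - 1)`. Minimality forces `ε_j ≥ 1`, and the
three cases are the partitions `3`, `2 + 1` and `1 + 1 + 1` of `Δm = 3`.
-/

namespace JacobianSyzygies

open MvPolynomial

section Grading

variable {σ R ι κ : Type*} [CommSemiring R]

theorem weightedHomogeneousComponent_mul {M : Type*} [AddCommGroup M] {w : σ → M}
    {p : MvPolynomial σ R} {m : M} (hp : IsWeightedHomogeneous w p m) (n : M)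
    (q : MvPolynomial σ R) :
    weightedHomogeneousComponent w n (p * q) = p * weightedHomogeneousComponent w (n - m) q := by
  classical
  let _ := weightedGradedAlgebra R w
  have h := DirectSum.coe_decompose_mul_add_of_left_mem (weightedHomogeneousSubmodule R w)
    (j := n - m) (b := q) hp
  rw [add_sub_cancel] at h
  simp_rw [← weightedDecomposition.decompose'_apply]
  exact h

/-- The component of integer degree `n` of a polynomial, which vanishes for `n < 0`. Integer
degrees are used so that the shift by a twist `S(-a)` never truncates. -/
noncomputable abbrev intComponent (n : ℤ) : MvPolynomial σ R →ₗ[R] MvPolynomial σ R :=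
  weightedHomogeneousComponent (fun _ => (1 : ℤ)) n

theorem weight_one_int (u : σ →₀ ℕ) : Finsupp.weight (fun _ => (1 : ℤ)) u = u.degree := by
  simp [Finsupp.weight_apply, Finsupp.degree_apply, Finsupp.sum]

theorem isHomogeneousInt_iff {p : S} {n : ℤ} :
    IsHomogeneousInt p n ↔ IsWeightedHomogeneous (fun _ => (1 : ℤ)) p n := by
  simp only [IsHomogeneousInt, IsWeightedHomogeneous, weight_one_int]

theorem isWeightedHomogeneous_one_natCast_iff {p : MvPolynomial σ R} {n : ℕ} :
    IsWeightedHomogeneous (fun _ => (1 : ℤ)) p n ↔ p.IsHomogeneous n := by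
  simp only [IsHomogeneous, IsWeightedHomogeneous, weight_one_int, Nat.cast_inj,
    Finsupp.degree_eq_weight_one]
  rfl

theorem eq_zero_of_isWeightedHomogeneous_neg {p : MvPolynomial σ R} {n : ℤ}
    (hp : IsWeightedHomogeneous (fun _ => (1 : ℤ)) p n) (hn : n < 0) : p = 0 :=
  hp.eq_zero_of_no_monomials fun u => by rw [weight_one_int]; lia

theorem intComponent_zero (p : MvPolynomial σ R) :
    intComponent 0 p = C (constantCoeff p) := by
  classical
  ext u
  rw [coeff_weightedHomogeneousComponent, weight_one_int, coeff_C, constantCoeff_eq]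
  obtain rfl | hu := eq_or_ne u 0
  · simp
  · simp [Finsupp.degree_eq_zero_iff, hu, hu.symm]

theorem range_weightedHomogeneousComponent {M : Type*} [AddCommMonoid M] (w : σ → M) (n : M) :
    LinearMap.range (weightedHomogeneousComponent (R := R) w n) =
      weightedHomogeneousSubmodule R w n :=
  le_antisymm (LinearMap.range_le_iff_comap.mpr <| eq_top_iff.mpr fun p _ =>
      weightedHomogeneousComponent_mem w p n)
    fun _ hp => ⟨_, hp.weightedHomogeneousComponent_same⟩

theorem weightedHomogeneousSubmodule_one_natCast (n : ℕ) :
    weightedHomogeneousSubmodule R (fun _ : σ => (1 : ℤ)) n = homogeneousSubmodule σ R n :=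
  Submodule.ext fun _ => isWeightedHomogeneous_one_natCast_iff

/-- The projection of `⨁ᵢ S(-aᵢ)` onto its component of degree `n`. -/
noncomputable def gradedProj (a : ι → ℤ) (n : ℤ) :
    (ι → MvPolynomial σ R) →ₗ[R] (ι → MvPolynomial σ R) :=
  LinearMap.pi fun i => intComponent (n - a i) ∘ₗ LinearMap.proj i

@[simp]
theorem gradedProj_apply (a : ι → ℤ) (n : ℤ) (v : ι → MvPolynomial σ R) (i : ι) :
    gradedProj a n v i = intComponent (n - a i) (v i) := rfl

theorem gradedProj_gradedProj (a : ι → ℤ) (n : ℤ) (v : ι → MvPolynomial σ R) :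
    gradedProj a n (gradedProj a n v) = gradedProj a n v :=
  funext fun _ =>
    (weightedHomogeneousComponent_isWeightedHomogeneous _ _).weightedHomogeneousComponent_same

theorem range_gradedProj (a : ι → ℤ) (n : ℤ) :
    LinearMap.range (gradedProj (σ := σ) (R := R) a n) = Submodule.pi Set.univ fun i =>
      weightedHomogeneousSubmodule R (fun _ => (1 : ℤ)) (n - a i) := by
  ext v
  refine ⟨?_, fun hv => ⟨v, funext fun i => (hv i trivial).weightedHomogeneousComponent_same⟩⟩
  rintro ⟨v, rfl⟩ i -
  exact weightedHomogeneousComponent_mem _ _ _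

theorem linearCombination_gradedProj [Fintype ι] {g : ι → MvPolynomial σ R} {a : ι → ℤ} {b : ℤ}
    (hg : ∀ i, IsWeightedHomogeneous (fun _ => (1 : ℤ)) (g i) (a i - b)) (n : ℤ)
    (v : ι → MvPolynomial σ R) :
    Fintype.linearCombination (MvPolynomial σ R) g (gradedProj a n v) =
      intComponent (n - b) (Fintype.linearCombination (MvPolynomial σ R) g v) := by
  simp only [Fintype.linearCombination_apply, map_sum, smul_eq_mul, gradedProj_apply]
  refine Finset.sum_congr rfl fun i _ => ?_
  rw [mul_comm, mul_comm (v i), weightedHomogeneousComponent_mul (hg i), sub_sub_sub_cancel_right]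

theorem linearCombination_gradedProj_pi [Fintype ι] {g : ι → κ → MvPolynomial σ R} {a : ι → ℤ}
    {b : κ → ℤ} (hg : ∀ i j, IsWeightedHomogeneous (fun _ => (1 : ℤ)) (g i j) (a i - b j)) (n : ℤ)
    (v : ι → MvPolynomial σ R) :
    Fintype.linearCombination (MvPolynomial σ R) g (gradedProj a n v) =
      gradedProj b n (Fintype.linearCombination (MvPolynomial σ R) g v) := by
  ext1 j
  simpa only [Fintype.linearCombination_apply, Finset.sum_apply, Pi.smul_apply, gradedProj_apply]
    using linearCombination_gradedProj (fun i => hg i j) n v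

theorem mulVecLin_eq_linearCombination [Fintype ι] {R : Type*} [CommSemiring R]
    (A : Matrix κ ι R) : A.mulVecLin = Fintype.linearCombination R A.col := by
  refine LinearMap.ext fun v => ?_
  simp only [Matrix.mulVecLin_apply, Matrix.mulVec_eq_sum, op_smul_eq_smul]
  rfl

theorem mulVecLin_gradedProj {ι κ : Type} [Fintype ι] {a : ι → ℤ} {b : κ → ℤ}
    {A : Matrix κ ι S} (hA : IsGradedMatrix a b A) (n : ℤ) (v : ι → S) :
    A.mulVecLin (gradedProj a n v) = gradedProj b n (A.mulVecLin v) := by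
  rw [mulVecLin_eq_linearCombination]
  exact linearCombination_gradedProj_pi (fun i j => isHomogeneousInt_iff.mp (hA j i)) n v

end Grading

section GradedDimension

variable {σ R K : Type*} [CommRing R] [Field K]

theorem finrank_pi_univ {ι : Type*} [Fintype ι] [StrongRankCondition R] {M : ι → Type*}
    [∀ i, AddCommGroup (M i)] [∀ i, Module R (M i)] (p : ∀ i, Submodule R (M i))
    [∀ i, Module.Free R (p i)] [∀ i, Module.Finite R (p i)] :
    Module.finrank R (Submodule.pi Set.univ p) = ∑ i, Module.finrank R (p i) := by
  let φ : (∀ i, p i) →ₗ[R] ∀ i, M i := LinearMap.pi fun i => (p i).subtype ∘ₗ LinearMap.proj i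
  have hφ : Function.Injective φ := fun v w h => funext fun i => Subtype.ext (congrFun h i)
  have hrange : LinearMap.range φ = Submodule.pi Set.univ p := by
    ext v
    refine ⟨?_, fun hv => ⟨fun i => ⟨v i, hv i trivial⟩, rfl⟩⟩
    rintro ⟨w, rfl⟩ i -
    exact (w i).2
  rw [← hrange, LinearMap.finrank_range_of_inj hφ, Module.finrank_pi_fintype]

theorem finrank_homogeneousSubmodule [Fintype σ] [StrongRankCondition R] (n : ℕ) :
    Module.finrank R (homogeneousSubmodule σ R n) = (Fintype.card σ + n - 1).choose n := by
  classical
  have e : homogeneousSubmodule σ R n ≃ₗ[R] ({u : σ →₀ ℕ | u.degree = n} →₀ R) :=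
    LinearEquiv.ofEq _ _ (homogeneousSubmodule_eq_finsupp_supported _ _ n) ≪≫ₗ
      AddMonoidAlgebra.supportedEquivFinsupp _
  have hs : {u : σ →₀ ℕ | u.degree = n} = ↑((Finset.univ : Finset σ).finsuppAntidiag n) := by
    ext u
    simp [Finset.mem_finsuppAntidiag, Finsupp.degree_eq_sum]
  rw [e.finrank_eq, hs, Module.finrank_finsupp_self]
  exact (Fintype.card_coe _).trans (Finset.card_finsuppAntidiag_nat_eq_choose _)

theorem fg_weightedHomogeneousSubmodule_one [Finite σ] (n : ℤ) :
    (weightedHomogeneousSubmodule R (fun _ : σ => (1 : ℤ)) n).FG := by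
  obtain hn | hn := le_or_gt 0 n
  · lift n to ℕ using hn
    rw [weightedHomogeneousSubmodule_one_natCast]
    exact homogeneousSubmodule_fg _ _ n
  · have h : weightedHomogeneousSubmodule R (fun _ : σ => (1 : ℤ)) n = ⊥ :=
      (Submodule.eq_bot_iff _).mpr fun p hp => eq_zero_of_isWeightedHomogeneous_neg hp hn
    exact h ▸ Submodule.fg_bot

instance [Finite σ] (n : ℤ) :
    Module.Finite R (weightedHomogeneousSubmodule R (fun _ : σ => (1 : ℤ)) n) :=
  Module.Finite.iff_fg.mpr (fg_weightedHomogeneousSubmodule_one n)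

instance {ι : Type*} [Finite σ] [Finite ι] (a : ι → ℤ) (n : ℤ) :
    Module.Finite R (LinearMap.range (gradedProj (σ := σ) (R := R) a n)) := by
  rw [range_gradedProj]
  exact Module.Finite.iff_fg.mpr (Submodule.fg_pi fun i => fg_weightedHomogeneousSubmodule_one _)

theorem finrank_range_gradedProj {ι : Type*} [Finite σ] [Fintype ι] (a : ι → ℤ) (n : ℤ) :
    Module.finrank K (LinearMap.range (gradedProj (σ := σ) (R := K) a n)) =
      ∑ i, Module.finrank K (weightedHomogeneousSubmodule K (fun _ : σ => (1 : ℤ)) (n - a i)) := by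
  rw [range_gradedProj, finrank_pi_univ]

theorem finrank_map_add_finrank_map_of_exact {D E F : Type*} [AddCommGroup D] [Module K D]
    [AddCommGroup E] [Module K E] [AddCommGroup F] [Module K F] {ψ : D →ₗ[K] E} {φ : E →ₗ[K] F}
    (hex : Function.Exact ψ φ) {q : D →ₗ[K] D} {p : E →ₗ[K] E} (hp : ∀ x, p (p x) = p x)
    (hq : ∀ x, ψ (q x) = p (ψ x)) [Module.Finite K (LinearMap.range p)] :
    Module.finrank K ((LinearMap.range p).map φ) + Module.finrank K ((LinearMap.range q).map ψ) =
      Module.finrank K (LinearMap.range p) := by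
  have hker : (LinearMap.range q).map ψ = LinearMap.range p ⊓ LinearMap.ker φ := by
    apply le_antisymm
    · rintro _ ⟨_, ⟨y, rfl⟩, rfl⟩
      exact ⟨⟨ψ y, (hq y).symm⟩, hex.apply_apply_eq_zero _⟩
    · rintro _ ⟨⟨y, rfl⟩, hy⟩
      obtain ⟨z, hz⟩ := (hex _).mp hy
      exact ⟨q z, ⟨z, rfl⟩, by rw [hq, hz, hp]⟩
  rw [hker, ← (φ.domRestrict (LinearMap.range p)).finrank_range_add_finrank_ker,
    LinearMap.range_domRestrict, LinearMap.ker_domRestrict, ← Submodule.map_comap_subtype,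
    Submodule.finrank_map_subtype_eq]

/-- The Hilbert function `k ↦ dim (K[σ] / I)_k`, for a homogeneous ideal `I`. -/
noncomputable def hilbertFunction (I : Ideal (MvPolynomial σ K)) (k : ℕ) : ℕ :=
  Module.finrank K ((homogeneousSubmodule σ K k).map (Ideal.Quotient.mkₐ K I).toLinearMap)

theorem hilbertFunction_anti [Finite σ] {I J : Ideal (MvPolynomial σ K)} (hIJ : I ≤ J) (k : ℕ) :
    hilbertFunction J k ≤ hilbertFunction I k := by
  have : Module.Finite K (homogeneousSubmodule σ K k) :=
    Module.Finite.iff_fg.mpr (homogeneousSubmodule_fg _ _ k)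
  have hcomp : (Ideal.Quotient.factorₐ K hIJ).toLinearMap ∘ₗ (Ideal.Quotient.mkₐ K I).toLinearMap =
      (Ideal.Quotient.mkₐ K J).toLinearMap := rfl
  unfold hilbertFunction
  rw [← hcomp, Submodule.map_comp]
  exact Submodule.finrank_map_le _ _

theorem hilbertFunction_span_add_finrank {ι : Type*} [Finite σ] [Fintype ι]
    {g : ι → MvPolynomial σ K} {a : ι → ℤ}
    (hg : ∀ i, IsWeightedHomogeneous (fun _ => (1 : ℤ)) (g i) (a i)) (k : ℕ) :
    hilbertFunction (Ideal.span (Set.range g)) k +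
      Module.finrank K ((LinearMap.range (gradedProj a k)).map
        ((Fintype.linearCombination (MvPolynomial σ K) g).restrictScalars K)) =
      Module.finrank K (homogeneousSubmodule σ K k) := by
  have hex : Function.Exact ((Fintype.linearCombination (MvPolynomial σ K) g).restrictScalars K)
      (Ideal.Quotient.mkₐ K (Ideal.span (Set.range g))).toLinearMap := fun p => by
    refine Ideal.Quotient.eq_zero_iff_mem.trans ?_
    rw [Ideal.span, ← Fintype.range_linearCombination]
    rfl
  have hrange := range_weightedHomogeneousComponent (R := K) (fun _ : σ => (1 : ℤ)) (k : ℤ)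
  have : Module.Finite K (LinearMap.range (intComponent (σ := σ) (R := K) k)) := by
    rw [hrange]
    infer_instance
  have h := finrank_map_add_finrank_map_of_exact hex (q := gradedProj a k) (p := intComponent k)
    (fun p =>
      (weightedHomogeneousComponent_isWeightedHomogeneous _ p).weightedHomogeneousComponent_same)
    (fun v => by simpa using linearCombination_gradedProj (b := 0) (by simpa using hg) k v)
  rwa [hrange, weightedHomogeneousSubmodule_one_natCast] at h

end GradedDimension

section PlaneCurves

variable {K : Type*} [Field K]

/-- The Hilbert polynomial `(k - a + 1) (k - a + 2) / 2` of the twist `S(-a)` of a polynomial ring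
`S` in three variables. -/
noncomputable def shiftedHilbertPoly (a : ℤ) : Polynomial ℚ :=
  Polynomial.C (1 / 2) * (Polynomial.X - Polynomial.C (a : ℚ) + 1) *
    (Polynomial.X - Polynomial.C (a : ℚ) + 2)

theorem eval_shiftedHilbertPoly (a : ℤ) (x : ℚ) :
    (shiftedHilbertPoly a).eval x = (x - a + 1) * (x - a + 2) / 2 := by
  simp only [shiftedHilbertPoly, Polynomial.eval_mul, Polynomial.eval_C, Polynomial.eval_add,
    Polynomial.eval_sub, Polynomial.eval_X, Polynomial.eval_one, Polynomial.eval_ofNat]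
  ring

theorem finrank_weightedHomogeneousSubmodule_sub {a n : ℤ} (han : a ≤ n) :
    (Module.finrank K (weightedHomogeneousSubmodule K (fun _ : Fin 3 => (1 : ℤ)) (n - a)) : ℚ) =
      (shiftedHilbertPoly a).eval (n : ℚ) := by
  obtain ⟨k, rfl⟩ := Int.le.dest han
  rw [add_sub_cancel_left, weightedHomogeneousSubmodule_one_natCast, finrank_homogeneousSubmodule,
    Fintype.card_fin, show 3 + k - 1 = k + 2 by lia, Nat.choose_symm_add, Nat.cast_choose_two,
    eval_shiftedHilbertPoly]
  push_cast
  ring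

theorem finrank_range_gradedProj_fin_three {ι : Type*} [Fintype ι] {a : ι → ℤ} {n : ℤ}
    (han : ∀ i, a i ≤ n) :
    (Module.finrank K (LinearMap.range (gradedProj (σ := Fin 3) (R := K) a n)) : ℚ) =
      ∑ i, (shiftedHilbertPoly (a i)).eval (n : ℚ) := by
  rw [finrank_range_gradedProj, Nat.cast_sum]
  exact Finset.sum_congr rfl fun i _ => finrank_weightedHomogeneousSubmodule_sub (han i)

theorem exact_toSpanSingleton_linearCombination {R : Type*} [CommRing R] [IsDomain R]
    [DecompositionMonoid R] {g h : R} (hg : g ≠ 0) (hgh : IsRelPrime g h) :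
    Function.Exact (LinearMap.toSpanSingleton R (Fin 2 → R) ![h, -g])
      (Fintype.linearCombination R ![g, h]) := by
  intro v
  simp only [Fintype.linearCombination_apply, Fin.sum_univ_two, smul_eq_mul,
    Matrix.cons_val_zero, Matrix.cons_val_one]
  constructor
  · intro hv
    obtain ⟨w, hw⟩ := hgh.dvd_of_dvd_mul_right
      (show g ∣ v 1 * h from ⟨-v 0, by linear_combination hv⟩)
    have hv0 : v 0 = -(h * w) := mul_left_cancel₀ hg (by linear_combination hv - h * hw)
    refine ⟨-w, funext fun i => ?_⟩
    fin_cases i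
    · simp [hv0, mul_comm]
    · simp [hw, mul_comm]
  · rintro ⟨w, rfl⟩
    simp only [LinearMap.toSpanSingleton_apply, Pi.smul_apply, Matrix.cons_val_zero, smul_eq_mul,
      Matrix.cons_val_one]
    ring

theorem finrank_map_linearCombination_pair_add {σ : Type*} [Finite σ] {g h : MvPolynomial σ K}
    {p q : ℤ} (hg : g ≠ 0) (hgp : IsWeightedHomogeneous (fun _ => (1 : ℤ)) g p)
    (hhq : IsWeightedHomogeneous (fun _ => (1 : ℤ)) h q) (hgh : IsRelPrime g h) (n : ℤ) :
    Module.finrank K ((LinearMap.range (gradedProj ![p, q] n)).map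
        ((Fintype.linearCombination (MvPolynomial σ K) ![g, h]).restrictScalars K)) +
      Module.finrank K (weightedHomogeneousSubmodule K (fun _ : σ => (1 : ℤ)) (n - (p + q))) =
      Module.finrank K (LinearMap.range (gradedProj (σ := σ) (R := K) ![p, q] n)) := by
  let ψ := (LinearMap.toSpanSingleton (MvPolynomial σ K) _ ![h, -g]).restrictScalars K
  have hψ : Function.Injective ψ := fun v w hvw =>
    mul_right_cancel₀ (neg_ne_zero.mpr hg) (by simpa [ψ] using congrFun hvw 1)
  have hψ_proj (w : MvPolynomial σ K) :
      ψ (intComponent (n - (p + q)) w) = gradedProj ![p, q] n (ψ w) := funext fun i => by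
    fin_cases i
    · simp [ψ, mul_comm _ h, weightedHomogeneousComponent_mul hhq, sub_sub]
    · simp [ψ, mul_comm _ g, weightedHomogeneousComponent_mul hgp, sub_sub, add_comm]
  have h_koszul := finrank_map_add_finrank_map_of_exact (K := K) (ψ := ψ)
    (φ := (Fintype.linearCombination (MvPolynomial σ K) ![g, h]).restrictScalars K)
    (exact_toSpanSingleton_linearCombination hg hgh) (gradedProj_gradedProj ![p, q] n) hψ_proj
  rwa [← (Submodule.equivMapOfInjective ψ hψ _).finrank_eq,
    range_weightedHomogeneousComponent] at h_koszul

theorem hilbertFunction_span_pair {g h : MvPolynomial (Fin 3) K} {p q : ℕ} (hg : g ≠ 0)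
    (hgp : g.IsHomogeneous p) (hhq : h.IsHomogeneous q) (hgh : IsRelPrime g h) {k : ℕ}
    (hk : p + q ≤ k) : hilbertFunction (Ideal.span {g, h}) k = p * q := by
  rw [← isWeightedHomogeneous_one_natCast_iff] at hgp hhq
  have h_ideal := hilbertFunction_span_add_finrank (g := ![g, h]) (a := ![(p : ℤ), q])
    (Fin.forall_fin_two.mpr ⟨hgp, hhq⟩) k
  have h_koszul := finrank_map_linearCombination_pair_add hg hgp hhq hgh k
  have h_pair := finrank_range_gradedProj_fin_three (K := K) (a := ![(p : ℤ), q]) (n := k)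
    (Fin.forall_fin_two.mpr ⟨by simp; lia, by simp; lia⟩)
  have h_syz := finrank_weightedHomogeneousSubmodule_sub (K := K) (a := p + q) (n := k)
    (by exact_mod_cast hk)
  have h_ring := finrank_weightedHomogeneousSubmodule_sub (K := K) (a := 0) (n := k) (by simp)
  rw [← h_koszul, Nat.cast_add, h_syz, Fin.sum_univ_two] at h_pair
  rw [sub_zero, weightedHomogeneousSubmodule_one_natCast, ← h_ideal, Nat.cast_add] at h_ring
  simp only [eval_shiftedHilbertPoly, Matrix.cons_val_zero, Matrix.cons_val_one] at h_pair h_ring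
  push_cast at h_pair h_ring
  rw [← Matrix.range_cons_cons_empty g h ![]]
  exact_mod_cast (by linear_combination h_ring - h_pair :
    (hilbertFunction (Ideal.span (Set.range ![g, h])) k : ℚ) = p * q)

end PlaneCurves

section Coprimality

variable {σ R : Type*} [CommRing R] [IsDomain R] [CharZero R]

theorem totalDegree_pderiv_lt {R : Type*} [CommSemiring R] {p : MvPolynomial σ R} {i : σ}
    (h : pderiv i p ≠ 0) : (pderiv i p).totalDegree < p.totalDegree := by
  obtain ⟨u, hu, hmax⟩ := Finset.exists_mem_eq_sup (pderiv i p).support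
    (support_nonempty.mpr h) fun u => u.sum fun _ e => e
  have hc : p.coeff (u + Finsupp.single i 1) ≠ 0 := by
    rw [mem_support_iff, coeff_pderiv] at hu
    exact left_ne_zero_of_mul hu
  have hle := le_totalDegree (mem_support_iff.mpr hc)
  rw [Finsupp.sum_add_index' (fun _ => rfl) (fun _ _ _ => rfl), Finsupp.sum_single_index rfl] at hle
  rwa [totalDegree, hmax]

theorem totalDegree_eq_zero_of_pderiv_eq_zero {p : MvPolynomial σ R} (h : ∀ i, pderiv i p = 0) :
    p.totalDegree = 0 := by
  rw [totalDegree_eq_zero_iff]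
  intro u hu i
  by_contra hi
  have hcoeff := congrArg (coeff (u - Finsupp.single i 1)) (h i)
  rw [coeff_pderiv, tsub_add_cancel_of_le (by rw [Finsupp.single_le_iff]; lia), coeff_zero]
    at hcoeff
  exact (mul_ne_zero (mem_support_iff.mp hu) (Nat.cast_add_one_ne_zero _)) hcoeff

theorem totalDegree_eq_zero_of_dvd_pderiv {p : MvPolynomial σ R} (h : ∀ i, p ∣ pderiv i p) :
    p.totalDegree = 0 := by
  refine totalDegree_eq_zero_of_pderiv_eq_zero fun i => ?_
  by_contra hi
  obtain ⟨q, hq⟩ := h i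
  have hlt := totalDegree_pderiv_lt hi
  rw [hq] at hi hlt
  rw [totalDegree_mul_of_isDomain (left_ne_zero_of_mul hi) (right_ne_zero_of_mul hi)] at hlt
  lia

theorem dvd_of_dvd_smul {K A : Type*} [Field K] [CommRing A] [Algebra K A] {t : K} (ht : t ≠ 0)
    {p a : A} (h : p ∣ t • a) : p ∣ a := by
  simpa only [inv_smul_smul₀ ht] using dvd_smul_of_dvd t⁻¹ h

theorem exists_not_dvd_pderiv [Finite σ] {K : Type*} [Field K] [CharZero K]
    {f p : MvPolynomial σ K} {d : ℕ} (hd : d ≠ 0) (hf : f.IsHomogeneous d) (hsq : Squarefree f)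
    (hp : Prime p) : ∃ i, ¬ p ∣ pderiv i f := by
  have _ := Fintype.ofFinite σ
  by_contra! h
  have hpf : p ∣ f := by
    have h_euler : p ∣ (d : K) • f := by
      rw [Nat.cast_smul_eq_nsmul, ← hf.sum_X_mul_pderiv]
      exact Finset.dvd_sum fun i _ => (h i).mul_left _
    exact dvd_of_dvd_smul (Nat.cast_ne_zero.mpr hd) h_euler
  obtain ⟨g, rfl⟩ := hpf
  have hg : ¬ p ∣ g := fun ⟨w, hw⟩ => hp.not_isUnit (hsq p ⟨w, by rw [hw, mul_assoc]⟩)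
  have hdeg := totalDegree_eq_zero_of_dvd_pderiv (p := p) fun i => by
    have hi := h i
    rw [pderiv_mul, dvd_add_left (dvd_mul_right _ _)] at hi
    exact (hp.dvd_or_dvd hi).resolve_right hg
  rw [totalDegree_eq_zero_iff_eq_C] at hdeg
  have hunit : IsUnit (coeff 0 p) :=
    isUnit_iff_ne_zero.mpr fun h0 => hp.ne_zero (by rw [hdeg, h0, map_zero])
  exact hp.not_isUnit (hdeg ▸ hunit.map C)

theorem exists_isRelPrime_add_smul {K A : Type*} [Field K] [Infinite K] [CommRing A] [IsDomain A]
    [UniqueFactorizationMonoid A] [Algebra K A] {g a b : A} (hg : g ≠ 0)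
    (h : ∀ p, Prime p → p ∣ g → p ∣ a → ¬ p ∣ b) : ∃ t : K, IsRelPrime g (a + t • b) := by
  classical
  by_contra! hcon
  -- By pigeonhole, one prime factor of `g` divides `a + t • b` for two values of `t`.
  have hfactor (t : K) : ∃ p ∈ UniqueFactorizationMonoid.factors g, p ∣ a + t • b := by
    have ht := hcon t
    rw [UniqueFactorizationMonoid.isRelPrime_iff_no_prime_factors hg] at ht
    push Not at ht
    obtain ⟨q, hqg, hqa, hq⟩ := ht
    obtain ⟨p, hp, hqp⟩ :=
      UniqueFactorizationMonoid.exists_mem_factors_of_dvd hg hq.irreducible hqg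
    exact ⟨p, hp, hqp.dvd_iff_dvd_left.mp hqa⟩
  choose p hp hpd using hfactor
  obtain ⟨s, t, hst, he⟩ := Finite.exists_ne_map_eq_of_infinite
    (fun t => (⟨p t, by simpa using hp t⟩ : (UniqueFactorizationMonoid.factors g).toFinset))
  replace he : p s = p t := congrArg Subtype.val he
  have hb : p s ∣ b := by
    refine dvd_of_dvd_smul (sub_ne_zero.mpr hst) ?_
    rw [sub_smul, ← add_sub_add_left_eq_sub _ _ a]
    exact dvd_sub (hpd s) (he ▸ hpd t)
  exact h _ (UniqueFactorizationMonoid.prime_of_factor _ (hp s))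
    (UniqueFactorizationMonoid.dvd_of_mem_factors (hp s))
    ((dvd_add_left (dvd_smul_of_dvd s hb)).mp (hpd s)) hb

theorem milnorDim_le {f : S} {d : ℕ} (hd : d ≠ 0) (hf : f.IsHomogeneous d) (hsq : Squarefree f)
    {k : ℕ} (hk : 2 * (d - 1) ≤ k) : milnorDim f k ≤ (d - 1) ^ 2 := by
  obtain ⟨i, hi⟩ := exists_not_dvd_pderiv hd hf hsq (X_prime (i := 0))
  have hi0 : pderiv i f ≠ 0 := fun h => hi (h ▸ dvd_zero _)
  obtain ⟨t, ht⟩ : ∃ t : ℂ, IsRelPrime (pderiv i f) (pderiv (i + 1) f + t • pderiv (i + 2) f) := by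
    refine exists_isRelPrime_add_smul hi0 fun p hp h₀ h₁ h₂ => ?_
    obtain ⟨j, hj⟩ := exists_not_dvd_pderiv hd hf hsq hp
    obtain rfl | rfl | rfl : j = i ∨ j = i + 1 ∨ j = i + 2 := by
      fin_cases i <;> fin_cases j <;> simp
    exacts [hj h₀, hj h₁, hj h₂]
  have hmem (j) : pderiv j f ∈ jacobianIdeal f := Ideal.subset_span ⟨j, rfl⟩
  have hle : Ideal.span {pderiv i f, pderiv (i + 1) f + t • pderiv (i + 2) f} ≤ jacobianIdeal f :=
    Ideal.span_le.mpr <| Set.insert_subset (hmem i) <| Set.singleton_subset_iff.mpr <|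
      add_mem (hmem _) (Submodule.smul_of_tower_mem _ t (hmem _))
  calc milnorDim f k ≤ hilbertFunction (Ideal.span _) k := hilbertFunction_anti hle k
    _ = (d - 1) ^ 2 := by
      have hhom : (pderiv (i + 1) f + t • pderiv (i + 2) f).IsHomogeneous (d - 1) :=
        hf.pderiv.add ((homogeneousSubmodule ..).smul_mem t hf.pderiv)
      rw [hilbertFunction_span_pair hi0 hf.pderiv hhom ht (by lia), sq]

end Coprimality

section HilbertPolynomial

theorem degree_le_zero_of_eventually_abs_eval_natCast_le {P : Polynomial ℚ} {c : ℚ}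
    (h : ∀ᶠ k : ℕ in atTop, |P.eval (k : ℚ)| ≤ c) : P.degree ≤ 0 := by
  by_contra! hP
  have hlim := (P.abs_tendsto_atTop hP).comp (tendsto_natCast_atTop_atTop (R := ℚ))
  obtain ⟨k, hk, hk'⟩ := (h.and (hlim.eventually_gt_atTop c)).exists
  exact hk.not_gt hk'

/-- The Hilbert polynomial of `M(f)` predicted by a resolution
`0 → ⨁ⱼ S(-eⱼ) → ⨁ᵢ S(1 - d - δᵢ) → S³(1 - d) → S`. -/
noncomputable def resolutionHilbertPoly (d : ℕ) {m n : ℕ} (δ : Fin m → ℕ) (e : Fin n → ℤ) :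
    Polynomial ℚ :=
  shiftedHilbertPoly 0 - (3 : ℚ) • shiftedHilbertPoly (d - 1) +
    ∑ i, shiftedHilbertPoly (d - 1 + δ i) - ∑ j, shiftedHilbertPoly (e j)

theorem shiftedHilbertPoly_eq (a : ℤ) : shiftedHilbertPoly a = Polynomial.C (1 / 2) *
    Polynomial.X ^ 2 + Polynomial.C (3 / 2 - (a : ℚ)) * Polynomial.X +
    Polynomial.C ((a ^ 2 - 3 * a + 2 : ℚ) / 2) := by
  refine Polynomial.funext fun x => ?_
  simp only [eval_shiftedHilbertPoly, Polynomial.eval_add, Polynomial.eval_mul, Polynomial.eval_C,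
    Polynomial.eval_pow, Polynomial.eval_X]
  ring

theorem coeff_zero_shiftedHilbertPoly (a : ℤ) :
    (shiftedHilbertPoly a).coeff 0 = (a ^ 2 - 3 * a + 2) / 2 := by
  simp [shiftedHilbertPoly_eq]

theorem coeff_one_shiftedHilbertPoly (a : ℤ) : (shiftedHilbertPoly a).coeff 1 = 3 / 2 - a := by
  rw [shiftedHilbertPoly_eq, Polynomial.coeff_add, Polynomial.coeff_add, Polynomial.coeff_C_mul,
    Polynomial.coeff_X_pow, Polynomial.coeff_C_mul_X, Polynomial.coeff_C]
  simp

theorem coeff_two_shiftedHilbertPoly (a : ℤ) : (shiftedHilbertPoly a).coeff 2 = 1 / 2 := by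
  rw [shiftedHilbertPoly_eq, Polynomial.coeff_add, Polynomial.coeff_add, Polynomial.coeff_C_mul,
    Polynomial.coeff_X_pow, Polynomial.coeff_C_mul_X, Polynomial.coeff_C]
  simp

variable {f : S} {d m n : ℕ} {δ : Fin m → ℕ} {e : Fin n → ℤ} {A : Matrix (Fin 3) (Fin m) S}
  {B : Matrix (Fin m) (Fin n) S}

theorem isWeightedHomogeneous_pderiv {σ R : Type*} [CommSemiring R] {f : MvPolynomial σ R}
    (hd : d ≠ 0) (hf : f.IsHomogeneous d) (i : σ) :
    IsWeightedHomogeneous (fun _ => (1 : ℤ)) (pderiv i f) (d - 1) := by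
  have h := isWeightedHomogeneous_one_natCast_iff.mpr (hf.pderiv (i := i))
  rwa [Nat.cast_sub (Nat.one_le_iff_ne_zero.mpr hd), Nat.cast_one] at h

theorem IsMinimalResolution.milnorDim_eq_eval (hd : d ≠ 0) (hf : f.IsHomogeneous d)
    (h : IsMinimalResolution f d δ e A B) {k : ℕ} (hdk : (d : ℤ) - 1 ≤ k)
    (hδk : ∀ i, (d : ℤ) - 1 + δ i ≤ k) (hek : ∀ j, e j ≤ k) :
    (milnorDim f k : ℚ) = (resolutionHilbertPoly d δ e).eval (k : ℚ) := by
  have h_ideal : milnorDim f k + _ = _ :=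
    hilbertFunction_span_add_finrank (isWeightedHomogeneous_pderiv hd hf) k
  have h_gradient := finrank_map_add_finrank_map_of_exact (K := ℂ)
    (ψ := A.mulVecLin.restrictScalars ℂ) (φ := (gradientMap f).restrictScalars ℂ) h.exact_gradient
    (gradedProj_gradedProj _ k) (mulVecLin_gradedProj h.graded_A k)
  have h_A := finrank_map_add_finrank_map_of_exact (K := ℂ)
    (ψ := B.mulVecLin.restrictScalars ℂ) (φ := A.mulVecLin.restrictScalars ℂ) h.exact_A
    (gradedProj_gradedProj _ k) (mulVecLin_gradedProj h.graded_B k)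
  rw [← (Submodule.equivMapOfInjective (B.mulVecLin.restrictScalars ℂ) h.injective_B _).finrank_eq]
    at h_A
  have h_ring := finrank_weightedHomogeneousSubmodule_sub (K := ℂ) (a := 0) (n := k) (by simp)
  have h_three := finrank_range_gradedProj_fin_three (K := ℂ) fun _ : Fin 3 => hdk
  have h_δ := finrank_range_gradedProj_fin_three (K := ℂ) hδk
  have h_e := finrank_range_gradedProj_fin_three (K := ℂ) hek
  rw [sub_zero, weightedHomogeneousSubmodule_one_natCast, ← h_ideal, Nat.cast_add] at h_ring
  rw [← h_gradient, Nat.cast_add, Fin.sum_const] at h_three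
  rw [← h_A, Nat.cast_add] at h_δ
  simp only [resolutionHilbertPoly, Polynomial.eval_sub, Polynomial.eval_add,
    Polynomial.eval_finsetSum, Polynomial.eval_smul]
  unfold gradientMap at h_three
  linear_combination h_ring - h_three + h_δ - h_e

theorem IsMinimalResolution.eventually_milnorDim_eq (hd : d ≠ 0) (hf : f.IsHomogeneous d)
    (h : IsMinimalResolution f d δ e A B) :
    ∀ᶠ k : ℕ in atTop, (milnorDim f k : ℚ) = (resolutionHilbertPoly d δ e).eval (k : ℚ) := by
  have h_ge (a : ℤ) : ∀ᶠ k : ℕ in atTop, a ≤ k :=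
    tendsto_natCast_atTop_atTop.eventually_ge_atTop a
  filter_upwards [h_ge (d - 1), eventually_all.mpr fun i => h_ge (d - 1 + δ i),
    eventually_all.mpr fun j => h_ge (e j)] with k hdk hδk hek
  exact h.milnorDim_eq_eval hd hf hdk hδk hek

theorem IsMinimalResolution.degree_resolutionHilbertPoly_le_zero (hd : d ≠ 0)
    (hf : f.IsHomogeneous d) (hsq : Squarefree f) (h : IsMinimalResolution f d δ e A B) :
    (resolutionHilbertPoly d δ e).degree ≤ 0 := by
  refine degree_le_zero_of_eventually_abs_eval_natCast_le (c := ((d - 1) ^ 2 : ℕ)) ?_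
  filter_upwards [h.eventually_milnorDim_eq hd hf, eventually_ge_atTop (2 * (d - 1))] with k hk hdk
  rw [← hk, Nat.abs_cast]
  exact_mod_cast milnorDim_le hd hf hsq hdk

theorem IsMinimalResolution.coeff_resolutionHilbertPoly_eq_zero (hd : d ≠ 0)
    (hf : f.IsHomogeneous d) (hsq : Squarefree f) (h : IsMinimalResolution f d δ e A B) {i : ℕ}
    (hi : 0 < i) : (resolutionHilbertPoly d δ e).coeff i = 0 :=
  Polynomial.coeff_eq_zero_of_degree_lt <|
    (h.degree_resolutionHilbertPoly_le_zero hd hf hsq).trans_lt (by exact_mod_cast hi)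

theorem IsMinimalResolution.eq_add_two (hd : d ≠ 0) (hf : f.IsHomogeneous d)
    (hsq : Squarefree f) (h : IsMinimalResolution f d δ e A B) : m = n + 2 := by
  have h2 := h.coeff_resolutionHilbertPoly_eq_zero hd hf hsq two_pos
  simp only [resolutionHilbertPoly, Polynomial.coeff_sub, Polynomial.coeff_add,
    Polynomial.coeff_smul, Polynomial.finsetSum_coeff, coeff_two_shiftedHilbertPoly,
    Fin.sum_const, nsmul_eq_mul, smul_eq_mul] at h2
  exact_mod_cast (by linear_combination 2 * h2 : (m : ℚ) = n + 2)

theorem IsMinimalResolution.sum_eq (hd : d ≠ 0) (hf : f.IsHomogeneous d)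
    (hsq : Squarefree f) (h : IsMinimalResolution f d δ e A B) :
    ∑ j, e j = ∑ i, ((d : ℤ) - 1 + δ i) - 3 * (d - 1) := by
  have h1 := h.coeff_resolutionHilbertPoly_eq_zero hd hf hsq one_pos
  have hm : (m : ℚ) = n + 2 := by exact_mod_cast h.eq_add_two hd hf hsq
  simp only [resolutionHilbertPoly, Polynomial.coeff_sub, Polynomial.coeff_add,
    Polynomial.coeff_smul, Polynomial.finsetSum_coeff, coeff_one_shiftedHilbertPoly,
    Finset.sum_sub_distrib, Fin.sum_const, nsmul_eq_mul, smul_eq_mul] at h1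
  rw [← @Int.cast_inj ℚ]
  push_cast at h1 ⊢
  linear_combination h1 - 3 / 2 * hm

theorem IsMinimalResolution.exists_isTotalTjurina (hd : d ≠ 0) (hf : f.IsHomogeneous d)
    (hsq : Squarefree f) (h : IsMinimalResolution f d δ e A B) :
    ∃ τ : ℕ, IsTotalTjurina f τ ∧
      (2 * τ : ℤ) = ∑ i, ((d : ℤ) - 1 + δ i) ^ 2 - 3 * (d - 1) ^ 2 - ∑ j, e j ^ 2 := by
  have hP := Polynomial.eq_C_of_degree_le_zero (h.degree_resolutionHilbertPoly_le_zero hd hf hsq)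
  have h_ev : ∀ᶠ k in atTop, (milnorDim f k : ℚ) = (resolutionHilbertPoly d δ e).coeff 0 := by
    filter_upwards [h.eventually_milnorDim_eq hd hf] with k hk
    rwa [hP, Polynomial.eval_C] at hk
  obtain ⟨k₀, hk₀⟩ := h_ev.exists
  refine ⟨milnorDim f k₀, h_ev.mono fun k hk => by exact_mod_cast hk.trans hk₀.symm, ?_⟩
  have hm : (m : ℚ) = n + 2 := by exact_mod_cast h.eq_add_two hd hf hsq
  have hsum := congrArg (Int.cast : ℤ → ℚ) (h.sum_eq hd hf hsq)
  simp only [resolutionHilbertPoly, Polynomial.coeff_sub, Polynomial.coeff_add,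
    Polynomial.coeff_smul, Polynomial.finsetSum_coeff, coeff_zero_shiftedHilbertPoly,
    ← Finset.sum_div, Finset.sum_add_distrib, Finset.sum_sub_distrib, ← Finset.mul_sum,
    Fin.sum_const, nsmul_eq_mul, smul_eq_mul] at hk₀
  rw [← @Int.cast_inj ℚ]
  push_cast at hk₀ hsum ⊢
  linear_combination 2 * hk₀ + 2 * hm + 3 * hsum

end HilbertPolynomial

section RegularSequences

open RingTheory.Sequence

variable {R : Type*} [CommRing R] {M N : Type*} [AddCommGroup M] [Module R M] [AddCommGroup N]
  [Module R N]

theorem isWeaklyRegular_of_flat [Module.Flat R M] {rs : List R} (h : IsWeaklyRegular R rs) :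
    IsWeaklyRegular M rs :=
  ((TensorProduct.rid R M).isWeaklyRegular_congr rs).mp h.isWeaklyRegular_lTensor

theorem mem_smul_top_ker {φ : M →ₗ[R] N} {rs : List R}
    (h : IsWeaklyRegular (LinearMap.range φ) rs) {x : LinearMap.ker φ}
    (hx : (x : M) ∈ (Ideal.ofList rs • ⊤ : Submodule R M)) :
    x ∈ (Ideal.ofList rs • ⊤ : Submodule R (LinearMap.ker φ)) := by
  have h_zero : Function.Exact (0 : PUnit →ₗ[R] LinearMap.ker φ) (LinearMap.ker φ).subtype :=
    LinearMap.exact_zero_iff_injective _ _ |>.mpr (LinearMap.ker φ).injective_subtype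
  have h_ker : Function.Exact (LinearMap.ker φ).subtype φ.rangeRestrict := by
    rw [LinearMap.exact_iff, LinearMap.ker_rangeRestrict, Submodule.range_subtype]
  have h_mod := map_first_exact_on_four_term_right_exact_of_isSMulRegular_last h_zero h_ker
    φ.surjective_rangeRestrict h
  obtain ⟨y, hy⟩ := (h_mod (Submodule.Quotient.mk x)).mp <| by
    rwa [Submodule.mapQ_apply, Submodule.subtype_apply, Submodule.Quotient.mk_eq_zero]
  obtain ⟨y, rfl⟩ := Submodule.Quotient.mk_surjective _ y
  rwa [Submodule.mapQ_apply, LinearMap.zero_apply, eq_comm, Submodule.Quotient.mk_zero,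
    Submodule.Quotient.mk_eq_zero] at hy

theorem isWeaklyRegular_ker {φ : M →ₗ[R] N} {rs : List R} {r : R}
    (hM : IsWeaklyRegular M (rs ++ [r])) (hφ : IsWeaklyRegular (LinearMap.range φ) rs) :
    IsWeaklyRegular (LinearMap.ker φ) (rs ++ [r]) := by
  induction rs using List.reverseRecOn generalizing r with
  | nil =>
    rw [List.nil_append, isWeaklyRegular_singleton_iff] at hM ⊢
    exact hM.submodule _ _
  | append_singleton rs s ih =>
    rw [isWeaklyRegular_append_iff, isWeaklyRegular_singleton_iff,
      isSMulRegular_quotient_iff_mem_of_smul_mem] at hM ⊢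
    refine ⟨ih hM.1 ((isWeaklyRegular_append_iff _ _ _).mp hφ).1, fun x hx => ?_⟩
    refine mem_smul_top_ker hφ (hM.2 x ?_)
    have hx' := Submodule.mem_map_of_mem (f := (LinearMap.ker φ).subtype) hx
    rw [Submodule.map_smul''] at hx'
    exact Submodule.smul_mono le_rfl le_top hx'

theorem injective_of_ker_le_smul_top [IsNoetherianRing R] [IsDomain R] [Module.IsTorsionFree R M]
    [Module.Finite R M] {φ : M →ₗ[R] N} {rs : List R} (hrs : Ideal.ofList rs ≠ ⊤)
    (hφ : IsWeaklyRegular (LinearMap.range φ) rs)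
    (hker : LinearMap.ker φ ≤ Ideal.ofList rs • ⊤) : Function.Injective φ := by
  have hle : (⊤ : Submodule R (LinearMap.ker φ)) ≤ Ideal.ofList rs • ⊤ := fun x _ =>
    mem_smul_top_ker hφ (hker x.2)
  -- Nakayama: some `r ≡ 1` modulo the ideal kills `ker φ`, and `M` is torsion-free.
  obtain ⟨r, hr, hr_smul⟩ := Submodule.exists_sub_one_mem_and_smul_eq_zero_of_fg_of_le_smul _ _
    Module.Finite.fg_top hle
  have hr0 : r ≠ 0 := by
    rintro rfl
    rw [zero_sub, neg_mem_iff] at hr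
    exact hrs ((Ideal.eq_top_iff_one _).mpr hr)
  refine (injective_iff_map_eq_zero φ).mpr fun x hx => ?_
  exact (smul_eq_zero.mp (congrArg Subtype.val (hr_smul ⟨x, hx⟩ trivial))).resolve_left hr0

theorem ofList_map_X {σ : Type*} (l : List σ) :
    (Ideal.ofList (l.map X) : Ideal (MvPolynomial σ R)) = Ideal.span (X '' {i | i ∈ l}) := by
  rw [Ideal.ofList]
  congr 1
  ext
  simp

theorem isWeaklyRegular_map_X {σ : Type*} {l : List σ} (hl : l.Nodup) :
    IsWeaklyRegular (MvPolynomial σ R) (l.map (X (R := R))) := by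
  induction l using List.reverseRecOn with
  | nil => exact .nil _ _
  | append_singleton l i ih =>
    obtain ⟨hl, -, hi⟩ := List.nodup_append'.mp hl
    rw [List.map_append, isWeaklyRegular_append_iff]
    refine ⟨ih hl, (isWeaklyRegular_singleton_iff _ _).mpr
      ((isSMulRegular_quotient_iff_mem_of_smul_mem _ _).mpr fun p hp => ?_)⟩
    rw [smul_eq_mul, Ideal.mul_top, ofList_map_X, mem_ideal_span_X_image] at hp ⊢
    intro u hu
    obtain ⟨j, hj, huj⟩ := hp (Finsupp.single i 1 + u) (by simpa [coeff_X_mul] using hu)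
    refine ⟨j, hj, ?_⟩
    have hij : i ≠ j := by
      rintro rfl
      exact hi hj (List.mem_singleton_self i)
    simpa [Finsupp.single_eq_of_ne' hij] using huj

end RegularSequences

section MinimalGenerators

variable {σ K ι κ : Type*} [Field K] {b : κ → ℤ} {e : ι → ℤ}
  {N : Submodule (MvPolynomial σ K) (κ → MvPolynomial σ K)} {g : ι → κ → MvPolynomial σ K}

/-- A family `g` of homogeneous elements of degrees `e` generating the submodule `N` of
`⨁ᵢ S(-bᵢ)`, none of which is redundant. -/
structure IsMinimalHomogeneousGenerators (b : κ → ℤ)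
    (N : Submodule (MvPolynomial σ K) (κ → MvPolynomial σ K)) (e : ι → ℤ)
    (g : ι → κ → MvPolynomial σ K) : Prop where
  homogeneous : ∀ j i, IsWeightedHomogeneous (fun _ => (1 : ℤ)) (g j i) (e j - b i)
  span_eq : Submodule.span (MvPolynomial σ K) (Set.range g) = N
  irredundant : ∀ j, g j ∉ Submodule.span (MvPolynomial σ K) (g '' {j}ᶜ)

theorem mem_span_image_compl_singleton {A M : Type*} [CommRing A] [AddCommGroup M] [Module A M]
    [Fintype ι] {v : ι → M} {a : ι → A} (ha : ∑ i, a i • v i = 0) {j : ι} (hj : IsUnit (a j)) :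
    v j ∈ Submodule.span A (v '' {j}ᶜ) := by
  classical
  rw [← Finset.add_sum_erase _ _ (Finset.mem_univ j), add_eq_zero_iff_eq_neg] at ha
  rw [← Submodule.smul_mem_iff_of_isUnit _ hj, ha]
  exact neg_mem <| Submodule.sum_mem _ fun i hi =>
    Submodule.smul_mem _ _ (Submodule.subset_span ⟨i, Finset.ne_of_mem_erase hi, rfl⟩)

theorem IsMinimalHomogeneousGenerators.constantCoeff_eq_zero [Fintype ι]
    (hg : IsMinimalHomogeneousGenerators b N e g) {a : ι → MvPolynomial σ K}
    (ha : Fintype.linearCombination (MvPolynomial σ K) g a = 0) (j : ι) :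
    constantCoeff (a j) = 0 := by
  have h := linearCombination_gradedProj_pi hg.homogeneous (e j) a
  rw [ha, map_zero, Fintype.linearCombination_apply] at h
  by_contra hj
  refine hg.irredundant j (mem_span_image_compl_singleton h ?_)
  rw [gradedProj_apply, sub_self, intComponent_zero]
  exact (isUnit_iff_ne_zero.mpr hj).map C

theorem mem_span_range_X_iff {R : Type*} [CommSemiring R] {p : MvPolynomial σ R} :
    p ∈ Ideal.span (Set.range X) ↔ constantCoeff p = 0 := by
  rw [← Set.image_univ, mem_ideal_span_X_image, constantCoeff_eq, ← notMem_support_iff]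
  refine ⟨fun h h0 => ?_, fun h u hu => ?_⟩
  · simpa using h 0 h0
  · obtain ⟨i, hi⟩ := Finsupp.ne_iff.mp (ne_of_mem_of_not_mem hu h)
    exact ⟨i, trivial, hi⟩

theorem IsMinimalHomogeneousGenerators.injective_linearCombination [Finite σ] [Fintype ι]
    (hg : IsMinimalHomogeneousGenerators b N e g) {l : List σ} (hl : ∀ i, i ∈ l)
    (hN : RingTheory.Sequence.IsWeaklyRegular N (l.map (X (R := K)))) :
    Function.Injective (Fintype.linearCombination (MvPolynomial σ K) g) := by
  classical
  have hX : (Ideal.ofList (l.map X) : Ideal (MvPolynomial σ K)) = Ideal.span (Set.range X) := by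
    rw [ofList_map_X, Set.eq_univ_of_forall (s := {i | i ∈ l}) hl, Set.image_univ]
  rw [← hg.span_eq, ← Fintype.range_linearCombination] at hN
  refine injective_of_ker_le_smul_top (fun h => ?_) hN fun a ha => ?_
  · rw [hX, Ideal.eq_top_iff_one, mem_span_range_X_iff, map_one] at h
    exact one_ne_zero h
  · rw [hX, pi_eq_sum_univ' a]
    exact Submodule.sum_mem _ fun j _ => Submodule.smul_mem_smul
      (mem_span_range_X_iff.mpr (hg.constantCoeff_eq_zero ha j)) trivial

theorem exists_sum_gradedProj_eq [Finite κ] (b : κ → ℤ) (v : κ → MvPolynomial σ K) :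
    ∃ s : Finset ℤ, ∑ n ∈ s, gradedProj b n v = v := by
  classical
  have _ := Fintype.ofFinite κ
  refine ⟨Finset.univ.biUnion fun i => (v i).support.image fun u => (u.degree : ℤ) + b i,
    funext fun i => ?_⟩
  ext u
  rw [Finset.sum_apply, coeff_sum]
  simp only [gradedProj_apply, coeff_weightedHomogeneousComponent, weight_one_int,
    eq_sub_iff_add_eq, Finset.sum_ite_eq]
  refine ite_eq_left_iff.mpr fun hu => (notMem_support_iff.mp fun hu' => hu ?_).symm
  exact Finset.mem_biUnion.mpr ⟨i, Finset.mem_univ i, Finset.mem_image_of_mem _ hu'⟩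

theorem span_homogeneous_eq [Finite κ] (hN : ∀ v ∈ N, ∀ n, gradedProj b n v ∈ N) :
    Submodule.span (MvPolynomial σ K) {v | v ∈ N ∧ ∃ n, gradedProj b n v = v} = N := by
  refine le_antisymm (Submodule.span_le.mpr fun v hv => hv.1) fun v hv => ?_
  obtain ⟨s, hs⟩ := exists_sum_gradedProj_eq b v
  rw [← hs]
  exact Submodule.sum_mem _ fun n _ =>
    Submodule.subset_span ⟨hN v hv n, n, gradedProj_gradedProj b n v⟩

theorem exists_finset_subset_span_eq_irredundant {A M : Type*} [CommRing A] [AddCommGroup M]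
    [Module A M] {s : Set M} (hs : (Submodule.span A s).FG) :
    ∃ t : Finset M, ↑t ⊆ s ∧ Submodule.span A (t : Set M) = Submodule.span A s ∧
      ∀ v ∈ t, v ∉ Submodule.span A ((t : Set M) \ {v}) := by
  classical
  obtain ⟨t₀, ht₀, hspan₀⟩ := (Submodule.fg_span_iff_fg_span_finset_subset s).mp hs
  obtain ⟨t, ⟨hts, hspan⟩, hmin⟩ := exists_minimal_of_wellFoundedLT
    (fun t : Finset M => ↑t ⊆ s ∧ Submodule.span A (t : Set M) = Submodule.span A s)
    ⟨t₀, ht₀, hspan₀.symm⟩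
  refine ⟨t, hts, hspan, fun v hv hv' => ?_⟩
  have h_erase : Submodule.span A (t.erase v : Set M) = Submodule.span A s := by
    rw [← hspan, Finset.coe_erase]
    refine le_antisymm (Submodule.span_mono Set.sdiff_subset) (Submodule.span_le.mpr fun w hw => ?_)
    obtain rfl | hwv := eq_or_ne w v
    · exact hv'
    · exact Submodule.subset_span ⟨hw, hwv⟩
  have h_subset : (t.erase v : Set M) ⊆ s := (Finset.coe_subset.mpr (t.erase_subset v)).trans hts
  exact Finset.notMem_erase v t (hmin ⟨h_subset, h_erase⟩ (t.erase_subset v) hv)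

theorem exists_isMinimalHomogeneousGenerators [Finite σ] [Finite κ]
    (hN : ∀ v ∈ N, ∀ n, gradedProj b n v ∈ N) :
    ∃ (n : ℕ) (e : Fin n → ℤ) (g : Fin n → κ → MvPolynomial σ K),
      Monotone e ∧ IsMinimalHomogeneousGenerators b N e g := by
  obtain ⟨t, ht, hspan, hirr⟩ := exists_finset_subset_span_eq_irredundant
    (IsNoetherian.noetherian (Submodule.span (MvPolynomial σ K)
      {v | v ∈ N ∧ ∃ n, gradedProj b n v = v}))
  rw [span_homogeneous_eq hN] at hspan
  choose e he using fun v : t => (ht v.2).2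
  let τ := t.equivFin.symm
  let π := (Tuple.sort (e ∘ τ)).trans τ
  refine ⟨t.card, e ∘ π, fun j => π j, Tuple.monotone_sort (e ∘ τ), fun j i => ?_, ?_, fun j => ?_⟩
  · rw [← he (π j)]
    exact weightedHomogeneousComponent_isWeightedHomogeneous _ _
  · rw [Set.range_comp' Subtype.val π, π.surjective.range_eq, Set.image_univ, Subtype.range_coe,
      hspan]
  · refine fun h => hirr (π j) (π j).2 (Submodule.span_mono ?_ h)
    rintro _ ⟨i, hi, rfl⟩
    exact ⟨(π i).2, fun hij => hi (π.injective (Subtype.ext hij))⟩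

end MinimalGenerators

section Resolution

theorem isWeaklyRegular_ker_of_exact {σ ι κ R : Type*} [Finite ι] [Finite κ] [CommRing R]
    {φ : (ι → MvPolynomial σ R) →ₗ[MvPolynomial σ R] (κ → MvPolynomial σ R)}
    {ψ : (κ → MvPolynomial σ R) →ₗ[MvPolynomial σ R] MvPolynomial σ R}
    (hex : Function.Exact φ ψ) {i j k : σ} (hijk : [i, j, k].Nodup) :
    RingTheory.Sequence.IsWeaklyRegular (LinearMap.ker φ) ([i, j, k].map (X (R := R))) := by
  have hijk_reg := isWeaklyRegular_map_X (R := R) hijk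
  have hij_reg : RingTheory.Sequence.IsWeaklyRegular (MvPolynomial σ R) ([X i] ++ [X j]) :=
    ((RingTheory.Sequence.isWeaklyRegular_append_iff _ ([X i] ++ [X j]) [X k]).mp hijk_reg).1
  have hi_reg := ((RingTheory.Sequence.isWeaklyRegular_append_iff _ [X i] [X j]).mp hij_reg).1
  rw [RingTheory.Sequence.isWeaklyRegular_singleton_iff] at hi_reg
  have hψ : RingTheory.Sequence.IsWeaklyRegular (LinearMap.range ψ) [(X i : MvPolynomial σ R)] :=
    (RingTheory.Sequence.isWeaklyRegular_singleton_iff _ _).mpr (hi_reg.submodule _ _)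
  have hφ := isWeaklyRegular_ker (isWeaklyRegular_of_flat hij_reg) hψ
  rw [LinearMap.exact_iff.mp hex] at hφ
  exact isWeaklyRegular_ker (isWeaklyRegular_of_flat hijk_reg) hφ

variable {f : S} {d m n : ℕ} {δ : Fin m → ℕ} {ρ : Fin m → Fin 3 → S}

theorem IsMinimalGenerators.isMinimalHomogeneousGenerators (hρ : IsMinimalGenerators f δ ρ)
    (c : ℤ) : IsMinimalHomogeneousGenerators (fun _ => c) (D0 f) (fun j => c + δ j) ρ where
  homogeneous j i := by
    rw [add_sub_cancel_left]
    exact isWeightedHomogeneous_one_natCast_iff.mpr (hρ.homogeneous j i)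
  span_eq := hρ.span_eq
  irredundant := hρ.irredundant

theorem IsMinimalGenerators.exact_gradientMap (hρ : IsMinimalGenerators f δ ρ) :
    Function.Exact (Matrix.of ρ).transpose.mulVecLin (gradientMap f) := by
  rw [LinearMap.exact_iff, mulVecLin_eq_linearCombination]
  exact (hρ.span_eq.symm.trans (Fintype.range_linearCombination S ρ).symm)

theorem IsMinimalGenerators.exists_isMinimalResolution (hρ : IsMinimalGenerators f δ ρ)
    (hδ : ∀ j, δ j ≠ 0) (d : ℕ) :
    ∃ (n : ℕ) (e : Fin n → ℤ) (A : Matrix (Fin 3) (Fin m) S) (B : Matrix (Fin m) (Fin n) S),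
      IsMinimalResolution f d δ e A B := by
  have hρ_min := hρ.isMinimalHomogeneousGenerators (d - 1)
  let A : Matrix (Fin 3) (Fin m) S := (Matrix.of ρ).transpose
  have hA_graded : IsGradedMatrix (fun j => (d : ℤ) - 1 + δ j) (fun _ => (d : ℤ) - 1) A :=
    fun i j => isHomogeneousInt_iff.mpr (hρ_min.homogeneous j i)
  have hA_ker : ∀ v ∈ LinearMap.ker A.mulVecLin, ∀ k,
      gradedProj (fun j => (d : ℤ) - 1 + δ j) k v ∈ LinearMap.ker A.mulVecLin := fun v hv k => by
    rw [LinearMap.mem_ker, mulVecLin_gradedProj hA_graded, hv, map_zero]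
  obtain ⟨n, e, g, he, hg⟩ := exists_isMinimalHomogeneousGenerators hA_ker
  have hg_relation (j : Fin n) : Fintype.linearCombination S ρ (g j) = 0 := by
    have hj : g j ∈ LinearMap.ker A.mulVecLin :=
      hg.span_eq ▸ Submodule.subset_span (Set.mem_range_self j)
    rwa [LinearMap.mem_ker, mulVecLin_eq_linearCombination] at hj
  refine ⟨n, e, A, (Matrix.of g).transpose, hρ.monotone, he, hA_graded,
    fun i j => isHomogeneousInt_iff.mpr (hg.homogeneous j i), hρ.exact_gradientMap, ?_, ?_,
    fun i j => ?_, fun i j => hρ_min.constantCoeff_eq_zero (hg_relation j) i⟩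
  · rw [LinearMap.exact_iff, mulVecLin_eq_linearCombination (Matrix.of g).transpose]
    exact hg.span_eq.symm.trans (Fintype.range_linearCombination S g).symm
  · rw [mulVecLin_eq_linearCombination]
    exact hg.injective_linearCombination (l := [0, 1, 2]) (by decide)
      (isWeaklyRegular_ker_of_exact hρ.exact_gradientMap (by decide))
  · exact (hρ.homogeneous j i).coeff_eq_zero (by simpa using (hδ j).symm)

end Resolution

section SyzygyDegrees

theorem eq_zero_of_isWeightedHomogeneous_nonpos {σ R : Type*} [CommSemiring R]
    {p : MvPolynomial σ R} {n : ℤ} (hp : IsWeightedHomogeneous (fun _ => (1 : ℤ)) p n)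
    (hn : n ≤ 0) (h0 : constantCoeff p = 0) : p = 0 := by
  obtain hn | rfl := hn.lt_or_eq
  · exact eq_zero_of_isWeightedHomogeneous_neg hp hn
  · rw [← hp.weightedHomogeneousComponent_same, intComponent_zero, h0, map_zero]

section

variable {f : S} {d m n : ℕ} {δ : Fin m → ℕ} {e : Fin n → ℤ} {A : Matrix (Fin 3) (Fin m) S}
  {B : Matrix (Fin m) (Fin n) S}

theorem IsMinimalResolution.exists_lt_shift (h : IsMinimalResolution f d δ e A B) (j : Fin n) :
    ∃ i, (d : ℤ) - 1 + δ i < e j := by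
  by_contra! hle
  have h_col : B.mulVecLin (Pi.single j 1) = 0 := by
    rw [Matrix.mulVecLin_apply, Matrix.mulVec_single_one]
    exact funext fun i => eq_zero_of_isWeightedHomogeneous_nonpos
      (isHomogeneousInt_iff.mp (h.graded_B i j)) (sub_nonpos.mpr (hle i)) (h.minimal_B i j)
  have h_single := (injective_iff_map_eq_zero _).mp h.injective_B _ h_col
  exact one_ne_zero (Pi.single_eq_zero_iff.mp h_single)

end

variable {f : S} {d r m : ℕ} {e : Fin (m - 2) → ℤ} {A : Matrix (Fin 3) (Fin m) S}
  {B : Matrix (Fin m) (Fin (m - 2)) S}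

theorem IsMinimalResolution.one_le_epsilon
    (h : IsMinimalResolution f d (fun _ => r) e A B) (j : Fin (m - 2)) :
    1 ≤ epsilon d (fun _ => r) e j := by
  obtain ⟨-, hj⟩ := h.exists_lt_shift j
  unfold epsilon
  lia

theorem IsMinimalResolution.sum_epsilon_sub_one (hd : d ≠ 0) (hf : f.IsHomogeneous d)
    (hsq : Squarefree f) (h : IsMinimalResolution f d (fun _ => r) e A B) :
    ∑ j, (epsilon d (fun _ => r) e j - 1) = deltaM d r m := by
  have hm : (m : ℤ) = (m - 2 : ℕ) + 2 := by exact_mod_cast h.eq_add_two hd hf hsq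
  have hsum := h.sum_eq hd hf hsq
  simp only [Fin.sum_const, nsmul_eq_mul] at hsum
  simp only [epsilon, deltaM, Finset.sum_sub_distrib, Fin.sum_const, nsmul_eq_mul]
  linear_combination hsum + (d + r : ℤ) * hm

theorem IsMinimalResolution.exists_isTotalTjurina_epsilon (hd : d ≠ 0) (hf : f.IsHomogeneous d)
    (hsq : Squarefree f) (h : IsMinimalResolution f d (fun _ => r) e A B) :
    ∃ τ : ℕ, IsTotalTjurina f τ ∧ (2 * τ : ℤ) = d * (d - 1) + 2 * r * (d - r - 2) -
      ∑ j, (epsilon d (fun _ => r) e j - 1) * epsilon d (fun _ => r) e j := by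
  obtain ⟨τ, hτ, h_sq⟩ := h.exists_isTotalTjurina hd hf hsq
  refine ⟨τ, hτ, ?_⟩
  have hm : (m : ℤ) = (m - 2 : ℕ) + 2 := by exact_mod_cast h.eq_add_two hd hf hsq
  have hsum := h.sum_eq hd hf hsq
  have h_expand (j : Fin (m - 2)) :
      (epsilon d (fun _ => r) e j - 1) * epsilon d (fun _ => r) e j =
        e j ^ 2 - (2 * (d + r - 1) + 1) * e j + (d + r - 1) * (d + r) := by
    unfold epsilon
    ring
  simp only [Fin.sum_const, nsmul_eq_mul] at hsum h_sq
  simp only [h_expand, Finset.sum_add_distrib, Finset.sum_sub_distrib, ← Finset.mul_sum,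
    Fin.sum_const, nsmul_eq_mul]
  linear_combination h_sq - (2 * (d + r - 1) + 1 : ℤ) * hsum - (d + r - 1) * (d + r) * hm

end SyzygyDegrees

section PartitionsOfThree

theorem eq_ite_of_monotone_of_le_one {n c : ℕ} {x : Fin n → ℤ} (hx : Monotone x)
    (h0 : ∀ j, 0 ≤ x j) (h1 : ∀ j, x j ≤ 1) (hsum : ∑ j, x j = c) :
    c ≤ n ∧ ∀ j, x j = if n ≤ j.val + c then 1 else 0 := by
  induction n generalizing c with
  | zero =>
    rw [Fin.sum_univ_zero] at hsum
    exact ⟨by lia, fun j => j.elim0⟩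
  | succ n ih =>
    obtain h_last | h_last : x (Fin.last n) = 0 ∨ x (Fin.last n) = 1 := by
      have := h0 (Fin.last n)
      have := h1 (Fin.last n)
      lia
    · have hx0 (j) : x j = 0 := le_antisymm (h_last ▸ hx (Fin.le_last j)) (h0 j)
      have hc : c = 0 := by simpa [hx0] using hsum.symm
      exact ⟨by lia, fun j => by rw [hx0, if_neg (by lia)]⟩
    · rw [Fin.sum_univ_castSucc, h_last] at hsum
      have := Finset.sum_nonneg fun j (_ : j ∈ Finset.univ) => h0 (Fin.castSucc j)
      obtain ⟨c, rfl⟩ : ∃ c' : ℕ, c = c' + 1 := Nat.exists_eq_succ_of_ne_zero (by lia)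
      obtain ⟨hcn, h_init⟩ := ih (c := c) (x := fun j => x j.castSucc)
        (hx.comp Fin.strictMono_castSucc.monotone) (fun j => h0 _) (fun j => h1 _)
        (by push_cast at hsum; lia)
      refine ⟨by lia, Fin.lastCases ?_ fun j => ?_⟩
      · rw [h_last, if_pos (by simp)]
      · simp only [h_init, Fin.val_castSucc, ← add_assoc, Nat.add_le_add_iff_right]

theorem exists_init_eq_ite_of_sum_eq_three {n : ℕ} {x : Fin (n + 1) → ℤ} (hx : Monotone x)
    (h0 : ∀ j, 0 ≤ x j) (hsum : ∑ j, x j = 3) :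
    ∃ c : ℕ, c ≤ 2 ∧ c ≤ n ∧ x (Fin.last n) = 3 - c ∧
      (∀ j : Fin n, x j.castSucc = if n ≤ j.val + c then 1 else 0) ∧
      ∑ j, x j * (x j + 1) = (3 - c) * (4 - c) + 2 * c := by
  rw [Fin.sum_univ_castSucc] at hsum
  have h_init_le (j : Fin n) : x j.castSucc ≤ ∑ j : Fin n, x j.castSucc :=
    Finset.single_le_sum (f := fun j : Fin n => x j.castSucc) (fun j _ => h0 _) (Finset.mem_univ j)
  have h_le_last (j : Fin n) : x j.castSucc ≤ x (Fin.last n) := hx (Fin.le_last _)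
  have h_le_one (j : Fin n) : x j.castSucc ≤ 1 := by
    have := h_init_le j
    have := h_le_last j
    lia
  have h_init_nonneg : 0 ≤ ∑ j : Fin n, x j.castSucc := Finset.sum_nonneg fun j _ => h0 _
  obtain ⟨c, hc⟩ := Int.eq_ofNat_of_zero_le h_init_nonneg
  obtain ⟨hcn, h_init⟩ := eq_ite_of_monotone_of_le_one (hx.comp Fin.strictMono_castSucc.monotone)
    (fun j => h0 _) h_le_one hc
  have h_last_ne : x (Fin.last n) ≠ 0 := fun h_last => by
    have : ∑ j : Fin n, x j.castSucc ≤ 0 := Finset.sum_nonpos fun j _ => h_last ▸ h_le_last j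
    lia
  have h_last := h0 (Fin.last n)
  have h_idem (j : Fin n) : x j.castSucc * (x j.castSucc + 1) = 2 * x j.castSucc := by
    obtain hj | hj : x j.castSucc = 0 ∨ x j.castSucc = 1 := by
      have := h0 j.castSucc
      have := h_le_one j
      lia
    all_goals simp [hj]
  refine ⟨c, by lia, hcn, by lia, h_init, ?_⟩
  rw [Fin.sum_univ_castSucc, Finset.sum_congr rfl fun j _ => h_idem j, ← Finset.mul_sum, hc,
    show x (Fin.last n) = 3 - c by lia]
  ring

theorem eq_ite_of_monotone_of_sum_eq_three {n : ℕ} {x : Fin n → ℤ} (hx : Monotone x)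
    (h0 : ∀ j, 0 ≤ x j) (hsum : ∑ j, x j = 3) :
    ((∀ j, x j = if j.val + 1 = n then 3 else 0) ∧ ∑ j, x j * (x j + 1) = 12) ∨
    ((∀ j, x j = if j.val + 1 = n then 2 else if j.val + 2 = n then 1 else 0) ∧
      ∑ j, x j * (x j + 1) = 8) ∨
    (3 ≤ n ∧ (∀ j, x j = if n ≤ j.val + 3 then 1 else 0) ∧ ∑ j, x j * (x j + 1) = 6) := by
  obtain _ | n := n
  · simp at hsum
  obtain ⟨c, hc, hcn, h_last, h_init, h_sq⟩ := exists_init_eq_ite_of_sum_eq_three hx h0 hsum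
  interval_cases c
  · refine .inl ⟨Fin.lastCases (by simp [h_last]) fun j => ?_, by simpa using h_sq⟩
    simp [h_init, j.isLt.ne]
  · refine .inr (.inl ⟨Fin.lastCases (by simp [h_last]) fun j => ?_, by simpa using h_sq⟩)
    rw [h_init, Fin.val_castSucc]
    split_ifs <;> lia
  · refine .inr (.inr ⟨by lia, Fin.lastCases (by simp [h_last]) fun j => ?_, by simpa using h_sq⟩)
    rw [h_init, Fin.val_castSucc]
    split_ifs <;> lia

end PartitionsOfThree

section Classification

theorem IsTotalTjurina.unique {f : S} {τ τ' : ℕ} (hτ : IsTotalTjurina f τ)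
    (hτ' : IsTotalTjurina f τ') : τ = τ' := by
  obtain ⟨k, hk, hk'⟩ := (hτ.and hτ').exists
  exact hk.symm.trans hk'

theorem IsMinimalResolution.epsilon_eq_of_deltaM_eq_three {f : S} {d r m : ℕ}
    {e : Fin (m - 2) → ℤ} {A : Matrix (Fin 3) (Fin m) S} {B : Matrix (Fin m) (Fin (m - 2)) S}
    (h : IsMinimalResolution f d (fun _ => r) e A B) (hd : d ≠ 0) (hf : f.IsHomogeneous d)
    (hsq : Squarefree f) (hΔ : deltaM d r m = 3) :
    ((∀ j, epsilon d (fun _ => r) e j = if j.val + 1 = m - 2 then 4 else 1) ∧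
      ∑ j, (epsilon d (fun _ => r) e j - 1) * epsilon d (fun _ => r) e j = 12) ∨
    ((∀ j, epsilon d (fun _ => r) e j =
        if j.val + 1 = m - 2 then 3 else if j.val + 1 = m - 3 then 2 else 1) ∧
      ∑ j, (epsilon d (fun _ => r) e j - 1) * epsilon d (fun _ => r) e j = 8) ∨
    (5 ≤ m ∧ (∀ j, epsilon d (fun _ => r) e j = if m - 4 ≤ j.val + 1 then 2 else 1) ∧
      ∑ j, (epsilon d (fun _ => r) e j - 1) * epsilon d (fun _ => r) e j = 6) := by
  have h_mono : Monotone fun j => epsilon d (fun _ => r) e j - 1 := fun i j hij => by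
    have := h.monotone_e hij
    simp only [epsilon]
    lia
  have h_nonneg (j) : 0 ≤ epsilon d (fun _ => r) e j - 1 := sub_nonneg.mpr (h.one_le_epsilon j)
  have h_sum := (h.sum_epsilon_sub_one hd hf hsq).trans hΔ
  obtain ⟨hε, h_sq⟩ | ⟨hε, h_sq⟩ | ⟨hm, hε, h_sq⟩ :=
    eq_ite_of_monotone_of_sum_eq_three h_mono h_nonneg h_sum <;>
  simp only [sub_add_cancel] at h_sq
  · refine .inl ⟨fun j => ?_, h_sq⟩
    rw [← sub_add_cancel (epsilon d _ e j) 1, hε]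
    split_ifs <;> rfl
  · refine .inr (.inl ⟨fun j => ?_, h_sq⟩)
    rw [← sub_add_cancel (epsilon d _ e j) 1, hε]
    split_ifs <;> lia
  · refine .inr (.inr ⟨by lia, fun j => ?_, h_sq⟩)
    rw [← sub_add_cancel (epsilon d _ e j) 1, hε]
    split_ifs <;> lia

theorem IsCurveOfType.exists_isMinimalResolution {f : S} {d r m : ℕ} (hC : IsCurveOfType f d r m)
    (hr : r ≠ 0) :
    ∃ (e : Fin (m - 2) → ℤ) (A : Matrix (Fin 3) (Fin m) S) (B : Matrix (Fin m) (Fin (m - 2)) S),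
      IsMinimalResolution f d (fun _ => r) e A B := by
  obtain ⟨hd, hf, hsq, ρ, hρ⟩ := hC
  obtain ⟨n, e, A, B, h⟩ := hρ.exists_isMinimalResolution (fun _ => hr) d
  obtain rfl : n = m - 2 := by
    have := h.eq_add_two (by lia) hf hsq
    lia
  exact ⟨e, A, B, h⟩

end Classification

end JacobianSyzygies

open JacobianSyzygies in
theorem mainTheorem5_general (f : S) (d r m : ℕ) (hC : IsCurveOfType f d r m)
    (hΔ : deltaM d r m = 3) :
    ∃ τ : ℕ, IsTotalTjurina f τ ∧
      (∃ (e : Fin (m - 2) → ℤ) (A : Matrix (Fin 3) (Fin m) S) (B : Matrix (Fin m) (Fin (m - 2)) S),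
        IsMinimalResolution f d (fun _ : Fin m => r) e A B) ∧
      ∀ (e : Fin (m - 2) → ℤ) (A : Matrix (Fin 3) (Fin m) S) (B : Matrix (Fin m) (Fin (m - 2)) S),
        IsMinimalResolution f d (fun _ : Fin m => r) e A B →
        ((∀ j : Fin (m - 2), epsilon d (fun _ : Fin m => r) e j =
              if j.val + 1 = m - 2 then 4 else 1) ∧
            (τ : ℚ) = (d : ℚ) * (d - 1) / 2 - 6 + r * ((d : ℚ) - r - 2)) ∨
        ((∀ j : Fin (m - 2), epsilon d (fun _ : Fin m => r) e j =
              if j.val + 1 = m - 2 then 3 else if j.val + 1 = m - 3 then 2 else 1) ∧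
            (τ : ℚ) = (d : ℚ) * (d - 1) / 2 - 4 + r * ((d : ℚ) - r - 2)) ∨
        (5 ≤ m ∧
          (∀ j : Fin (m - 2), epsilon d (fun _ : Fin m => r) e j =
              if m - 4 ≤ j.val + 1 then 2 else 1) ∧
            (τ : ℚ) = (d : ℚ) * (d - 1) / 2 - 3 + r * ((d : ℚ) - r - 2)) := by
  have hr : r ≠ 0 := by
    unfold deltaM at hΔ
    have := hC.1
    lia
  obtain ⟨e, A, B, h⟩ := hC.exists_isMinimalResolution hr
  obtain ⟨hd, hf, hsq, -⟩ := hC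
  have hd0 : d ≠ 0 := by lia
  obtain ⟨τ, hτ, -⟩ := h.exists_isTotalTjurina_epsilon hd0 hf hsq
  refine ⟨τ, hτ, ⟨e, A, B, h⟩, fun e' A' B' h' => ?_⟩
  obtain ⟨τ', hτ', h_eq⟩ := h'.exists_isTotalTjurina_epsilon hd0 hf hsq
  obtain rfl := hτ.unique hτ'
  obtain ⟨hε, h_sq⟩ | ⟨hε, h_sq⟩ | ⟨hm, hε, h_sq⟩ :=
    h'.epsilon_eq_of_deltaM_eq_three hd0 hf hsq hΔ <;>
  rw [h_sq, ← Int.cast_inj (α := ℚ)] at h_eq <;> push_cast at h_eq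
  · exact .inl ⟨hε, by linear_combination h_eq / 2⟩
  · exact .inr (.inl ⟨hε, by linear_combination h_eq / 2⟩)
  · exact .inr (.inr ⟨hm, hε, by linear_combination h_eq / 2⟩)

open JacobianSyzygies in
theorem mainTheorem5 (f : S) (d r m : ℕ) (hC : IsCurveOfType f d r m) (hm : 3 < m)
    (hΔ : deltaM d r m = 3) :
    ∃ τ : ℕ, IsTotalTjurina f τ ∧
      (∃ (e : Fin (m - 2) → ℤ) (A : Matrix (Fin 3) (Fin m) S) (B : Matrix (Fin m) (Fin (m - 2)) S),
        IsMinimalResolution f d (fun _ : Fin m => r) e A B) ∧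
      ∀ (e : Fin (m - 2) → ℤ) (A : Matrix (Fin 3) (Fin m) S) (B : Matrix (Fin m) (Fin (m - 2)) S),
        IsMinimalResolution f d (fun _ : Fin m => r) e A B →
        -- `ε_{m-2} = 4` and `ε_j = 1` for `j ≤ m - 3`
        ((∀ j : Fin (m - 2), epsilon d (fun _ : Fin m => r) e j =
              if j.val + 1 = m - 2 then 4 else 1) ∧
            (τ : ℚ) = (d : ℚ) * (d - 1) / 2 - 6 + r * ((d : ℚ) - r - 2)) ∨
        -- `ε_{m-2} = 3`, `ε_{m-3} = 2` and `ε_j = 1` for `j ≤ m - 4`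
        ((∀ j : Fin (m - 2), epsilon d (fun _ : Fin m => r) e j =
              if j.val + 1 = m - 2 then 3 else if j.val + 1 = m - 3 then 2 else 1) ∧
            (τ : ℚ) = (d : ℚ) * (d - 1) / 2 - 4 + r * ((d : ℚ) - r - 2)) ∨
        -- `m ≥ 5`, `ε_{m-2} = ε_{m-3} = ε_{m-4} = 2` and `ε_j = 1` for `j ≤ m - 5`
        (5 ≤ m ∧
          (∀ j : Fin (m - 2), epsilon d (fun _ : Fin m => r) e j =
              if m - 4 ≤ j.val + 1 then 2 else 1) ∧
            (τ : ℚ) = (d : ℚ) * (d - 1) / 2 - 3 + r * ((d : ℚ) - r - 2)) :=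
  mainTheorem5_general f d r m hC hΔ
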